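/- For complex numbers $a,q$ with $|q|<1$ write $(a;q)_n=\prod_{j=0}^{n-1}(1-aq^j)$ (so $(a;q)_0=1$), $(a;q)_\infty=\prod_{j=0}^{\infty}(1-aq^j)$ and $(a_1,\dots,a_k;q)_\infty=(a_1;q)_\infty\cdots(a_k;q)_\infty$. Then for every complex number $q$ with $|q|<1$ the following two series converge absolutely and $$\sum_{n=0}^{\infty}\frac{(-q^2;q^2)_{n+1}\,q^{n^2+2n}}{(q;q)_{2n+3}}=2\,(-q^2,-q^{14},q^{16};q^{16})_{\infty}\,\frac{(-q;q^{2})_{\infty}}{(q^2;q^{2})_{\infty}}-\frac{1}{1-q},$$ $$\sum_{n=0}^{\infty}\frac{(-q^2;q^2)_{n}\,q^{n^2}}{(q;q)_{2n+1}}=2\,\frac{(q^2,q^{14},q^{16};q^{16})_{\infty}\,(q^{12},q^{20};q^{32})_{\infty}}{(q;q)_{\infty}}-1.$$ -/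

import Mathlib

noncomputable section

/-- The finite `q`-shifted factorial `(a;q)_n = ∏_{j=0}^{n-1} (1 - a q^j)`, with `(a;q)_0 = 1`. -/
def qPoch (a q : ℂ) (n : ℕ) : ℂ := ∏ j ∈ Finset.range n, (1 - a * q ^ j)

/-- The infinite `q`-shifted factorial `(a;q)_∞ = ∏_{j=0}^∞ (1 - a q^j)`, used for `‖q‖ < 1`. -/
def qPochInf (a q : ℂ) : ℂ := ∏' j : ℕ, (1 - a * q ^ j)

/-- For `‖q‖ < 1` the infinite product converges, so `qPochInf` is its genuine value. -/
theorem qPochInf_hasProd (a : ℂ) {q : ℂ} (hq : ‖q‖ < 1) :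
    HasProd (fun j : ℕ => 1 - a * q ^ j) (qPochInf a q) := by
  have h : Summable (fun j : ℕ => ‖-(a * q ^ j)‖) := by
    simpa [norm_mul, norm_pow] using
      (summable_geometric_of_lt_one (norm_nonneg q) hq).mul_left ‖a‖
  have hm := multipliable_one_add_of_summable h
  simpa [sub_eq_add_neg, qPochInf] using hm.hasProd

/-- `(a;q)_∞` is the limit of the finite products `(a;q)_n`. -/
theorem qPochInf_tendsto (a : ℂ) {q : ℂ} (hq : ‖q‖ < 1) :
    Filter.Tendsto (fun n : ℕ => qPoch a q n) Filter.atTop (nhds (qPochInf a q)) :=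
  (qPochInf_hasProd a hq).tendsto_prod_nat

end

open Filter Topology

/-! ### Elementary properties of `q`-shifted factorials -/

/-! Both series are the same one up to a shift: multiplying the `n`-th term of the first by `q`
gives the term of index `n + 1` of the second. The second is a limiting `q`-Gauss sum, with value `Q
= (-q;q^2)_∞ / (q;q^2)_∞` (`hasSum_second`).

The theta products come from `theta_dissection`: the Jacobi triple product, split by parity of the
index, writes `(-q;q^2)_∞ (q^4;q^4)_∞` as `thetaSix q + q * thetaTwo q`, and `q ↦ -q` changes only
the middle sign. Adding and subtracting the two versions expresses `Q + 1` through `thetaSix` and `Q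
- 1` through `thetaTwo`.

The `q`-Gauss sum and the triple product are both proved from scratch, by dominated convergence. -/

lemma qPoch_zero (a q : ℂ) : qPoch a q 0 = 1 := by simp [qPoch]

lemma qPoch_succ (a q : ℂ) (n : ℕ) : qPoch a q (n + 1) = qPoch a q n * (1 - a * q ^ n) := by
  simp [qPoch, Finset.prod_range_succ]

lemma qPoch_add (a q : ℂ) (m n : ℕ) :
    qPoch a q (m + n) = qPoch a q m * qPoch (a * q ^ m) q n := by
  simp only [qPoch, Finset.prod_range_add]
  congr 1
  exact Finset.prod_congr rfl fun j _ => by ring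

lemma qPoch_succ_left (a q : ℂ) (n : ℕ) :
    qPoch a q (n + 1) = (1 - a) * qPoch (a * q) q n := by
  rw [add_comm, qPoch_add]
  simp [qPoch]

lemma qPoch_ne_zero {a q : ℂ} (h : ∀ n : ℕ, a * q ^ n ≠ 1) (n : ℕ) : qPoch a q n ≠ 0 :=
  Finset.prod_ne_zero_iff.2 fun j _ => sub_ne_zero.2 (h j).symm

lemma mul_pow_ne_one {a q : ℂ} (ha : ‖a‖ < 1) (hq : ‖q‖ < 1) (n : ℕ) : a * q ^ n ≠ 1 := by
  intro h
  have h1 : ‖a * q ^ n‖ < 1 := by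
    rw [norm_mul, norm_pow]
    exact (mul_le_of_le_one_right (norm_nonneg a)
      (pow_le_one₀ (norm_nonneg q) hq.le)).trans_lt ha
  simp [h] at h1

lemma qPoch_norm_le (a : ℂ) {q : ℂ} (hq : ‖q‖ < 1) : ∃ C > 0, ∀ n, ‖qPoch a q n‖ ≤ C := by
  obtain ⟨C, hC⟩ := (qPochInf_tendsto a hq).norm.bddAbove_range
  refine ⟨max C 1, by positivity, fun n => le_max_of_le_left (hC ⟨n, rfl⟩)⟩

lemma qPochInf_ne_zero {a q : ℂ} (hq : ‖q‖ < 1) (h : ∀ n : ℕ, a * q ^ n ≠ 1) :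
    qPochInf a q ≠ 0 := by
  have hs : Summable (fun j : ℕ => ‖-(a * q ^ j)‖) := by
    simpa [norm_mul, norm_pow] using
      (summable_geometric_of_lt_one (norm_nonneg q) hq).mul_left ‖a‖
  have := tprod_one_add_ne_zero_of_summable (f := fun j : ℕ => -(a * q ^ j))
    (fun j => by rw [← sub_eq_add_neg]; exact sub_ne_zero.2 (h j).symm) hs
  simpa [sub_eq_add_neg, qPochInf] using this

lemma qPoch_inv_norm_le {a q : ℂ} (hq : ‖q‖ < 1) (h : ∀ n : ℕ, a * q ^ n ≠ 1) :
    ∃ C > 0, ∀ n, ‖(qPoch a q n)⁻¹‖ ≤ C := by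
  obtain ⟨C, hC⟩ :=
    ((qPochInf_tendsto a hq).inv₀ (qPochInf_ne_zero hq h)).norm.bddAbove_range
  refine ⟨max C 1, by positivity, fun n => le_max_of_le_left (hC ⟨n, rfl⟩)⟩

lemma qPochInf_zero (q : ℂ) : qPochInf 0 q = 1 := by simp [qPochInf]

lemma norm_pow_lt_one {q : ℂ} (hq : ‖q‖ < 1) {n : ℕ} (hn : n ≠ 0) : ‖q ^ n‖ < 1 := by
  rw [norm_pow]
  exact pow_lt_one₀ (norm_nonneg q) hq hn

/-- Splitting an infinite product into its factors of even and of odd index. -/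
lemma qPochInf_split (a : ℂ) {q : ℂ} (hq : ‖q‖ < 1) :
    qPochInf a q = qPochInf a (q ^ 2) * qPochInf (a * q) (q ^ 2) := by
  have hq2 := norm_pow_lt_one hq two_ne_zero
  refine (qPochInf_hasProd a hq).unique (HasProd.even_mul_odd ?_ ?_)
  · simpa only [pow_mul] using qPochInf_hasProd a hq2
  · convert qPochInf_hasProd (a * q) hq2 using 2 with j
    ring

lemma qPochInf_mul_neg (a : ℂ) {q : ℂ} (hq : ‖q‖ < 1) :
    qPochInf a q * qPochInf (-a) q = qPochInf (a ^ 2) (q ^ 2) := by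
  have h := (qPochInf_hasProd a hq).mul (qPochInf_hasProd (-a) hq)
  refine h.unique ?_
  convert qPochInf_hasProd (a ^ 2) (norm_pow_lt_one hq two_ne_zero) using 2 with j
  ring

/-! ### The limiting `q`-Gauss sum -/

lemma succ_choose_two (n : ℕ) : (n + 1).choose 2 = n.choose 2 + n := by
  rw [Nat.choose_succ_succ' n 1, Nat.choose_one_right, add_comm]

lemma summable_pow_mul_pow_choose {p : ℂ} (hp : ‖p‖ < 1) (z : ℂ) :
    Summable fun n : ℕ => ‖z‖ ^ n * ‖p‖ ^ n.choose 2 := by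
  rcases eq_or_ne z 0 with rfl | hz
  · exact summable_of_ne_finset_zero (s := {0}) fun n hn => by
      simp at hn
      simp [hn]
  rcases eq_or_ne p 0 with rfl | hp0
  · exact summable_of_ne_finset_zero (s := {0, 1}) fun n hn => by
      simp at hn
      have : 0 < n.choose 2 := Nat.choose_pos (by omega)
      simp [this.ne']
  have hz' : 0 < ‖z‖ := norm_pos_iff.2 hz
  have hp' : 0 < ‖p‖ := norm_pos_iff.2 hp0
  refine summable_of_ratio_test_tendsto_lt_one (l := 0) zero_lt_one
    (Eventually.of_forall fun n => by positivity) ?_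
  have : Tendsto (fun n : ℕ => ‖z‖ * ‖p‖ ^ n) atTop (𝓝 (‖z‖ * 0)) :=
    (tendsto_pow_atTop_nhds_zero_of_lt_one hp'.le hp).const_mul _
  rw [mul_zero] at this
  refine this.congr fun n => ?_
  rw [Real.norm_of_nonneg (by positivity), Real.norm_of_nonneg (by positivity), succ_choose_two]
  field_simp
  ring

/-- The general term of the limiting `q`-Gauss series. -/
noncomputable def qGaussTerm (a p z : ℂ) (n : ℕ) : ℂ :=
  qPoch a p n * (-z) ^ n * p ^ n.choose 2 / (qPoch p p n * qPoch (a * z) p n)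

/-- The constant must not depend on `k`, so that the bound can dominate the limit `z * p ^ k → 0`.
The moving denominator is harmless because `1/(a z p^k;p)_n = (a z;p)_k / (a z;p)_{k+n}`. -/
lemma qGaussTerm_norm_le {a p z : ℂ} (hp : ‖p‖ < 1) (h : ∀ n : ℕ, a * z * p ^ n ≠ 1) :
    ∃ C > 0, ∀ k n, ‖qGaussTerm a p (z * p ^ k) n‖ ≤ C * (‖z * p ^ k‖ ^ n * ‖p‖ ^ n.choose 2) := by
  obtain ⟨A, hA, hA'⟩ := qPoch_norm_le a hp
  obtain ⟨B, hB, hB'⟩ := qPoch_inv_norm_le hp (mul_pow_ne_one hp hp)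
  obtain ⟨D, hD, hD'⟩ := qPoch_norm_le (a * z) hp
  obtain ⟨E, hE, hE'⟩ := qPoch_inv_norm_le hp h
  refine ⟨A * B * (D * E), by positivity, fun k n => ?_⟩
  have h1 : (qPoch (a * (z * p ^ k)) p n)⁻¹ = qPoch (a * z) p k * (qPoch (a * z) p (k + n))⁻¹ := by
    rw [qPoch_add, mul_assoc a z]
    have := qPoch_ne_zero h k
    rw [mul_inv, mul_inv_cancel_left₀ this]
  have h2 : qGaussTerm a p (z * p ^ k) n = qPoch a p n * (qPoch p p n)⁻¹ *
      (qPoch (a * z) p k * (qPoch (a * z) p (k + n))⁻¹) *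
      ((-(z * p ^ k)) ^ n * p ^ n.choose 2) := by
    rw [← h1, qGaussTerm, div_eq_mul_inv, mul_inv]
    ring
  rw [h2]
  simp only [norm_mul _ (_ * _), norm_mul (qPoch a p n), norm_mul (qPoch (a * z) p k),
    norm_mul ((-(z * p ^ k)) ^ n), norm_pow (-(z * p ^ k)), norm_neg, norm_pow p (n.choose 2)]
  gcongr
  exacts [hA' n, hB' n, hD' k, hE' _]

lemma qGaussTerm_summable {a p z : ℂ} (hp : ‖p‖ < 1) (h : ∀ n : ℕ, a * z * p ^ n ≠ 1) :
    Summable (qGaussTerm a p z) := by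
  obtain ⟨C, -, hC⟩ := qGaussTerm_norm_le hp h
  refine Summable.of_norm_bounded ((summable_pow_mul_pow_choose hp z).mul_left C) fun n => ?_
  simpa using hC 0 n

/-- Term-level form of the functional equation under `z ↦ z * p`. The certificate `(1 - p ^ n) *
qGaussTerm a p z n` vanishes at `n = 0` and tends to `0`, so nothing survives summation. -/
lemma qGaussTerm_telescope {a p z : ℂ} (hp : ‖p‖ < 1) (h : ∀ n : ℕ, a * z * p ^ n ≠ 1) (n : ℕ) :
    (1 - a * z) * qGaussTerm a p z n - (1 - z) * qGaussTerm a p (z * p) n =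
      (1 - a * z) * ((1 - p ^ n) * qGaussTerm a p z n -
        (1 - p ^ (n + 1)) * qGaussTerm a p z (n + 1)) := by
  have h0 : 1 - a * z ≠ 0 := sub_ne_zero.2 (by simpa using (h 0).symm)
  have hn : 1 - a * z * p ^ n ≠ 0 := sub_ne_zero.2 (h n).symm
  have hP := qPoch_ne_zero (mul_pow_ne_one hp hp) n
  have hP' : 1 - p * p ^ n ≠ 0 := sub_ne_zero.2 (mul_pow_ne_one hp hp n).symm
  have hQ := qPoch_ne_zero h n
  have hs : qPoch (a * (z * p)) p n = qPoch (a * z) p n * (1 - a * z * p ^ n) / (1 - a * z) := by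
    rw [eq_div_iff h0, ← qPoch_succ, qPoch_succ_left]
    ring_nf
  simp only [qGaussTerm, qPoch_succ, succ_choose_two, hs]
  rw [pow_succ' p n]
  field_simp
  ring

lemma qGauss_tsum_step {a p z : ℂ} (hp : ‖p‖ < 1) (h : ∀ n : ℕ, a * z * p ^ n ≠ 1) :
    (1 - a * z) * ∑' n, qGaussTerm a p z n = (1 - z) * ∑' n, qGaussTerm a p (z * p) n := by
  have h' : ∀ n : ℕ, a * (z * p) * p ^ n ≠ 1 := fun n => by
    have := h (n + 1)
    rwa [pow_succ', ← mul_assoc, mul_assoc a z p] at this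
  have s1 := qGaussTerm_summable hp h
  have s2 := qGaussTerm_summable hp h'
  rw [← sub_eq_zero, ← tsum_mul_left, ← tsum_mul_left,
    ← (s1.mul_left _).tsum_sub (s2.mul_left _)]
  refine HasSum.tsum_eq ?_
  refine (((s1.mul_left _).sub (s2.mul_left _)).hasSum_iff_tendsto_nat).2 ?_
  simp only [qGaussTerm_telescope hp h, ← Finset.mul_sum]
  simp only [Finset.sum_range_sub']
  have t1 : Tendsto (fun n : ℕ => 1 - p ^ n) atTop (𝓝 (1 - 0)) :=
    (tendsto_pow_atTop_nhds_zero_of_norm_lt_one hp).const_sub 1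
  simpa using ((t1.mul s1.tendsto_atTop_zero).const_mul (1 - a * z)).neg

lemma qGauss_tsum_iterate {a p z : ℂ} (hp : ‖p‖ < 1) (h : ∀ n : ℕ, a * z * p ^ n ≠ 1) (k : ℕ) :
    qPoch (a * z) p k * ∑' n, qGaussTerm a p z n =
      qPoch z p k * ∑' n, qGaussTerm a p (z * p ^ k) n := by
  induction k with
  | zero => simp [qPoch_zero]
  | succ k ih =>
    have h' : ∀ n : ℕ, a * (z * p ^ k) * p ^ n ≠ 1 := fun n => by
      have := h (k + n)
      rwa [pow_add, ← mul_assoc, mul_assoc a z] at this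
    have e := qGauss_tsum_step hp h'
    rw [qPoch_succ, qPoch_succ, mul_right_comm, ih, pow_succ, ← mul_assoc z,
      mul_assoc (qPoch z p k) (1 - _), ← e]
    ring

/-- As the argument shrinks to `0` only the term `n = 0` survives; this fixes the constant left open
by the functional equation. -/
lemma qGauss_tsum_tendsto {a p z : ℂ} (hp : ‖p‖ < 1) (h : ∀ n : ℕ, a * z * p ^ n ≠ 1) :
    Tendsto (fun k : ℕ => ∑' n, qGaussTerm a p (z * p ^ k) n) atTop (𝓝 1) := by
  obtain ⟨C, hC, hb⟩ := qGaussTerm_norm_le hp h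
  have hz : Tendsto (fun k : ℕ => ‖z * p ^ k‖) atTop (𝓝 0) := by
    simpa using ((tendsto_pow_atTop_nhds_zero_of_norm_lt_one hp).const_mul z).norm
  have hle : ∀ k : ℕ, ‖z * p ^ k‖ ≤ ‖z‖ := fun k => by
    rw [norm_mul, norm_pow]
    exact mul_le_of_le_one_right (norm_nonneg z) (pow_le_one₀ (norm_nonneg p) hp.le)
  have key : Tendsto (fun k : ℕ => ∑' n, qGaussTerm a p (z * p ^ k) n) atTop
      (𝓝 (∑' n : ℕ, if n = 0 then (1 : ℂ) else 0)) := by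
    refine tendsto_tsum_of_dominated_convergence
      ((summable_pow_mul_pow_choose hp z).mul_left C) (fun n => ?_)
      (Eventually.of_forall fun k n => (hb k n).trans ?_)
    · rcases eq_or_ne n 0 with rfl | hn
      · simp [qGaussTerm, qPoch_zero]
      · rw [if_neg hn]
        refine squeeze_zero_norm (fun k => hb k n) ?_
        simpa [hn] using ((hz.pow n).mul_const (‖p‖ ^ n.choose 2)).const_mul C
    · gcongr
      exact hle k
  simpa using key

/-- The limiting case `b → ∞` of the `q`-Gauss sum. -/
theorem qGauss_hasSum {a p z : ℂ} (hp : ‖p‖ < 1) (h : ∀ n : ℕ, a * z * p ^ n ≠ 1) :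
    HasSum (qGaussTerm a p z) (qPochInf z p / qPochInf (a * z) p) := by
  have e : ∑' n, qGaussTerm a p z n = qPochInf z p / qPochInf (a * z) p := by
    rw [eq_div_iff (qPochInf_ne_zero hp h), mul_comm]
    refine tendsto_nhds_unique ((qPochInf_tendsto (a * z) hp).mul_const _) ?_
    simpa [qGauss_tsum_iterate hp h] using
      (qPochInf_tendsto z hp).mul (qGauss_tsum_tendsto hp h)
  exact e ▸ (qGaussTerm_summable hp h).hasSum
/-! ### The Jacobi triple product -/

/-- The Gaussian binomial coefficient. -/
noncomputable def gaussBinom (p : ℂ) : ℕ → ℕ → ℂ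
  | _, 0 => 1
  | 0, _ + 1 => 0
  | n + 1, k + 1 => gaussBinom p n (k + 1) + p ^ (n - k) * gaussBinom p n k

lemma gaussBinom_zero_right (p : ℂ) (n : ℕ) : gaussBinom p n 0 = 1 := by
  cases n <;> rfl

lemma gaussBinom_succ_succ (p : ℂ) (n k : ℕ) : gaussBinom p (n + 1) (k + 1) =
    gaussBinom p n (k + 1) + p ^ (n - k) * gaussBinom p n k := rfl

lemma gaussBinom_eq_zero_of_lt (p : ℂ) : ∀ {n k : ℕ}, n < k → gaussBinom p n k = 0
  | _, 0, h => absurd h (Nat.not_lt_zero _)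
  | 0, _ + 1, _ => rfl
  | n + 1, k + 1, h => by
    rw [gaussBinom_succ_succ, gaussBinom_eq_zero_of_lt p (by omega : n < k + 1),
      gaussBinom_eq_zero_of_lt p (by omega : n < k)]
    simp

lemma gaussBinom_self (p : ℂ) (n : ℕ) : gaussBinom p n n = 1 := by
  induction n with
  | zero => rfl
  | succ n ih => simp [gaussBinom_succ_succ, gaussBinom_eq_zero_of_lt, ih]

lemma gaussBinom_add_mul (p : ℂ) (N : ℕ) : ∀ i j : ℕ, i + j = N →
    gaussBinom p N i * (qPoch p p i * qPoch p p j) = qPoch p p N := by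
  induction N with
  | zero =>
    intro i j h
    obtain ⟨rfl, rfl⟩ : i = 0 ∧ j = 0 := by omega
    simp [gaussBinom_self, qPoch_zero]
  | succ N ih =>
    intro i j h
    rcases i with _ | i
    · obtain rfl : j = N + 1 := by omega
      simp [gaussBinom_zero_right, qPoch_zero]
    rcases j with _ | j
    · obtain rfl : i = N := by omega
      simp [gaussBinom_self, qPoch_zero]
    have h1 := ih (i + 1) j (by omega)
    have h2 := ih i (j + 1) (by omega)
    have h3 : N - i = j + 1 := by omega
    have h4 : N = i + (j + 1) := by omega
    rw [qPoch_succ] at h1 h2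
    rw [gaussBinom_succ_succ, h3, qPoch_succ, qPoch_succ, qPoch_succ]
    have h5 : p ^ N = p ^ i * p ^ (j + 1) := by rw [h4, pow_add]
    rw [h5]
    -- This rests on `1 - p^(N+1) = (1 - p^(j+1)) + p^(j+1) (1 - p^(i+1))`, where `N = i + j + 1`.
    linear_combination (1 - p * p ^ j) * h1 + p ^ (j + 1) * (1 - p * p ^ i) * h2

/-- The finite `q`-binomial theorem. -/
lemma qPoch_neg_eq_sum (p x : ℂ) (N : ℕ) :
    qPoch (-x) p N = ∑ m ∈ Finset.range (N + 1), gaussBinom p N m * p ^ m.choose 2 * x ^ m := by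
  induction N with
  | zero => simp [qPoch_zero, gaussBinom_self]
  | succ N ih =>
    have e1 : ∀ m ∈ Finset.range (N + 1),
        gaussBinom p (N + 1) (m + 1) * p ^ (m + 1).choose 2 * x ^ (m + 1) =
          gaussBinom p N (m + 1) * p ^ (m + 1).choose 2 * x ^ (m + 1) +
            x * p ^ N * (gaussBinom p N m * p ^ m.choose 2 * x ^ m) := fun m hm => by
      have hm' : p ^ N = p ^ (N - m) * p ^ m := by
        rw [← pow_add, Nat.sub_add_cancel (by simpa [Nat.lt_succ_iff] using hm)]
      rw [gaussBinom_succ_succ, succ_choose_two, hm']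
      ring
    rw [Finset.sum_range_succ', Finset.sum_congr rfl e1, Finset.sum_add_distrib, ← Finset.mul_sum,
      ← ih, qPoch_succ]
    have e2 := Finset.sum_range_succ' (fun m => gaussBinom p N m * p ^ m.choose 2 * x ^ m) (N + 1)
    rw [Finset.sum_range_succ, ← ih, gaussBinom_eq_zero_of_lt p N.lt_succ_self] at e2
    simp only [gaussBinom_zero_right] at e2 ⊢
    linear_combination e2

/-- Each factor obeys `1 + z p^(-i) = z p^(-i) (1 + p^i / z)` for `1 ≤ i ≤ n`. This turns the
factors with negative powers of `p` into the second product of the triple product. -/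
lemma qPoch_reflect {p z : ℂ} (hp : p ≠ 0) (hz : z ≠ 0) (n : ℕ) :
    qPoch (-(z * (p ^ n)⁻¹)) p n * p ^ (n + 1).choose 2 = z ^ n * qPoch (-(p / z)) p n := by
  induction n with
  | zero => simp [qPoch_zero]
  | succ n ih =>
    have e : -(z * (p ^ (n + 1))⁻¹) * p = -(z * (p ^ n)⁻¹) := by
      rw [pow_succ]
      field_simp
    rw [qPoch_succ_left, e, qPoch_succ, succ_choose_two (n + 1), pow_add]
    have e2 : (1 - -(z * (p ^ (n + 1))⁻¹)) * p ^ (n + 1) = z * (1 - -(p / z) * p ^ n) := by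
      field_simp
      ring
    linear_combination (1 - -(z * (p ^ (n + 1))⁻¹)) * p ^ (n + 1) * ih +
      z ^ n * qPoch (-(p / z)) p n * e2

/-- The general term of the theta series `∑ z ^ k p ^ (k (k - 1) / 2)`. -/
noncomputable def thetaTerm (p z : ℂ) (k : ℤ) : ℂ := z ^ k * p ^ (k * (k - 1) / 2)

lemma two_mul_triangle (k : ℤ) : 2 * (k * (k - 1) / 2) = k * (k - 1) :=
  Int.mul_ediv_cancel' (even_iff_two_dvd.1 (Int.even_mul_pred_self k))

lemma two_mul_choose_two (n : ℕ) : 2 * (n.choose 2 : ℤ) = n * (n - 1) := by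
  induction n with
  | zero => simp
  | succ n ih =>
    rw [succ_choose_two]
    push_cast
    linear_combination ih

lemma thetaTerm_natCast (p z : ℂ) (n : ℕ) : thetaTerm p z n = z ^ n * p ^ n.choose 2 := by
  have : (n : ℤ) * (n - 1) / 2 = (n.choose 2 : ℕ) := by
    have h1 := two_mul_triangle n
    have h2 := two_mul_choose_two n
    linarith
  rw [thetaTerm, this, zpow_natCast, zpow_natCast]

lemma thetaTerm_neg_natCast {p : ℂ} (hp : p ≠ 0) (z : ℂ) (n : ℕ) :
    thetaTerm p z (-n) = (p / z) ^ n * p ^ n.choose 2 := by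
  have : -(n : ℤ) * (-n - 1) / 2 = (n : ℕ) + (n.choose 2 : ℕ) := by
    have h1 := two_mul_triangle (-n)
    have h2 := two_mul_choose_two n
    linarith
  rw [thetaTerm, this, zpow_add₀ hp, zpow_natCast, zpow_natCast, zpow_neg, zpow_natCast, div_pow]
  ring

lemma thetaTerm_norm_summable {p z : ℂ} (hp : ‖p‖ < 1) (hp0 : p ≠ 0) :
    Summable fun k => ‖thetaTerm p z k‖ := by
  refine Summable.of_nat_of_neg ?_ ?_
  · simpa [thetaTerm_natCast] using summable_pow_mul_pow_choose hp z
  · simpa [thetaTerm_neg_natCast hp0] using summable_pow_mul_pow_choose hp (p / z)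

/-- The general term of the finite Jacobi triple product. -/
noncomputable def finiteThetaTerm (p z : ℂ) (n : ℕ) (k : ℤ) : ℂ :=
  if k ∈ Finset.Icc (-n : ℤ) n then gaussBinom p (2 * n) (k + n).toNat * thetaTerm p z k else 0

/-- The finite `q`-binomial theorem of order `2 n` at `z p^(-n)`, recentred by `k = m - n`. -/
lemma finiteTheta_hasSum {p z : ℂ} (hp : p ≠ 0) (hz : z ≠ 0) (n : ℕ) :
    HasSum (finiteThetaTerm p z n) (qPoch (-z) p n * qPoch (-(p / z)) p n) := by
  have hs : qPoch (-z) p n * qPoch (-(p / z)) p n =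
      ∑ k ∈ Finset.Icc (-n : ℤ) n, finiteThetaTerm p z n k := by
    have h1 := qPoch_neg_eq_sum p (z * (p ^ n)⁻¹) (n + n)
    have e : -(z * (p ^ n)⁻¹) * p ^ n = -z := by field_simp
    rw [qPoch_add, e] at h1
    have h2 := qPoch_reflect hp hz n
    have h3 : qPoch (-z) p n * qPoch (-(p / z)) p n = (z ^ n)⁻¹ * p ^ (n + 1).choose 2 *
        ∑ m ∈ Finset.range (n + n + 1),
          gaussBinom p (n + n) m * p ^ m.choose 2 * (z * (p ^ n)⁻¹) ^ m := by
      rw [← h1, mul_assoc, eq_inv_mul_iff_mul_eq₀ (pow_ne_zero n hz)]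
      linear_combination -qPoch (-z) p n * h2
    rw [h3, Finset.mul_sum]
    refine Finset.sum_bij (fun m _ => (m : ℤ) - n) (fun m hm => ?_) (fun a _ b _ h => ?_)
      (fun k hk => ?_) (fun m hm => ?_)
    · simp at hm ⊢
      omega
    · simpa using h
    · simp at hk
      refine ⟨(k + n).toNat, by simp; omega, by omega⟩
    · have hk : ((m : ℤ) - n) ∈ Finset.Icc (-n : ℤ) n := by
        simp at hm ⊢
        omega
      have hexp : ((m : ℤ) - n) * ((m : ℤ) - n - 1) / 2 =
          ((n + 1).choose 2 : ℕ) + (m.choose 2 : ℕ) - (n * m : ℕ) := by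
        have t1 := two_mul_triangle ((m : ℤ) - n)
        have t2 := two_mul_choose_two (n + 1)
        have t3 := two_mul_choose_two m
        push_cast at t2 t3 ⊢
        linarith
      rw [finiteThetaTerm, if_pos hk, thetaTerm, hexp, zpow_sub₀ hp, zpow_add₀ hp, zpow_sub₀ hz]
      simp only [zpow_natCast, sub_add_cancel, Int.toNat_natCast, two_mul, mul_pow, inv_pow,
        pow_mul]
      ring
  rw [hs]
  exact hasSum_sum_of_ne_finset_zero fun k hk => if_neg hk

lemma gaussBinom_norm_le {p : ℂ} (hp : ‖p‖ < 1) :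
    ∃ C > 0, ∀ N i, i ≤ N → ‖gaussBinom p N i‖ ≤ C := by
  have hne := mul_pow_ne_one hp hp
  obtain ⟨A, hA, hA'⟩ := qPoch_norm_le p hp
  obtain ⟨B, hB, hB'⟩ := qPoch_inv_norm_le hp hne
  refine ⟨A * (B * B), by positivity, fun N i h => ?_⟩
  have e : gaussBinom p N i = qPoch p p N * ((qPoch p p i)⁻¹ * (qPoch p p (N - i))⁻¹) := by
    rw [← gaussBinom_add_mul p N i (N - i) (by omega)]
    have h1 := qPoch_ne_zero hne i
    have h2 := qPoch_ne_zero hne (N - i)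
    field_simp
  rw [e, norm_mul, norm_mul]
  gcongr
  exacts [hA' _, hB' _, hB' _]

lemma finiteThetaTerm_tendsto {p : ℂ} (hp : ‖p‖ < 1) (z : ℂ) (k : ℤ) :
    Tendsto (fun n => finiteThetaTerm p z n k) atTop (𝓝 ((qPochInf p p)⁻¹ * thetaTerm p z k)) := by
  have hne := mul_pow_ne_one hp hp
  have hI := qPochInf_ne_zero hp hne
  have hlim := qPochInf_tendsto p hp
  have l1 : Tendsto (fun n : ℕ => 2 * n) atTop atTop :=
    tendsto_id.const_mul_atTop' two_pos
  have l2 : ∀ m : ℤ, Tendsto (fun n : ℕ => (m + n).toNat) atTop atTop := fun m =>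
    tendsto_atTop.2 fun b => by
      filter_upwards [eventually_ge_atTop (b + m.natAbs)] with n hn
      omega
  -- The binomial coefficient is `(p;p)_{2n} / ((p;p)_{n+k} (p;p)_{n-k})`; all three factors tend to
  -- `(p;p)_∞`, leaving one inverse.
  have hq := (hlim.comp l1).mul
    (((hlim.comp (l2 k)).inv₀ hI).mul ((hlim.comp (l2 (-k))).inv₀ hI))
  rw [mul_inv_cancel_left₀ hI] at hq
  refine (hq.mul_const _).congr' ?_
  filter_upwards [eventually_ge_atTop k.natAbs] with n hn
  have hk : k ∈ Finset.Icc (-n : ℤ) n := by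
    simp
    omega
  rw [finiteThetaTerm, if_pos hk]
  have := gaussBinom_add_mul p (2 * n) (k + n).toNat (-k + n).toNat (by omega)
  simp only [Function.comp_apply]
  rw [← this]
  have h1 := qPoch_ne_zero hne (k + n).toNat
  have h2 := qPoch_ne_zero hne (-k + n).toNat
  field_simp

/-- The Jacobi triple product identity. -/
theorem jacobi_triple_product {p z : ℂ} (hp : ‖p‖ < 1) (hp0 : p ≠ 0) (hz : z ≠ 0) :
    HasSum (thetaTerm p z) (qPochInf (-z) p * qPochInf (-(p / z)) p * qPochInf p p) := by
  have hI := qPochInf_ne_zero hp (mul_pow_ne_one hp hp)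
  have hs := thetaTerm_norm_summable (z := z) hp hp0
  obtain ⟨C, hC, hb⟩ := gaussBinom_norm_le hp
  have key := tendsto_tsum_of_dominated_convergence (𝓕 := atTop) (hs.mul_left C)
    (finiteThetaTerm_tendsto hp z) (Eventually.of_forall fun n k => by
      rw [finiteThetaTerm]
      split_ifs with h
      · rw [norm_mul]
        gcongr
        simp at h
        exact hb _ _ (by omega)
      · simp
        positivity)
  simp only [(finiteTheta_hasSum hp0 hz _).tsum_eq, tsum_mul_left] at key
  have e := tendsto_nhds_unique key ((qPochInf_tendsto (-z) hp).mul (qPochInf_tendsto (-(p / z)) hp))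
  rw [← e, mul_right_comm, inv_mul_cancel₀ hI, one_mul]
  exact hs.of_norm.hasSum
/-! ### Theta functions to the moduli `4` and `16` -/

lemma HasSum.int_even_add_odd {f : ℤ → ℂ} {a b : ℂ} (ha : HasSum (fun k => f (2 * k)) a)
    (hb : HasSum (fun k => f (2 * k + 1)) b) : HasSum f (a + b) := by
  have i1 : Function.Injective fun k : ℤ => 2 * k := fun x y h => by simpa using h
  have i2 : Function.Injective fun k : ℤ => 2 * k + 1 := fun x y h => by simpa using h
  have e1 : (Set.range fun k : ℤ => 2 * k) = {n | Even n} := by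
    ext k
    simp [even_iff_exists_two_mul, eq_comm (a := k)]
  have e2 : (Set.range fun k : ℤ => 2 * k + 1) = {n | Odd n} := by
    ext k
    simp [Odd, eq_comm (a := k)]
  have hc : IsCompl (Set.range fun k : ℤ => 2 * k) (Set.range fun k : ℤ => 2 * k + 1) := by
    rw [e1, e2]
    exact Int.isCompl_even_odd
  exact (i1.hasSum_range_iff.2 ha).add_isCompl hc (i2.hasSum_range_iff.2 hb)

lemma thetaTerm_pow {q : ℂ} (hq : q ≠ 0) (a b : ℕ) (k : ℤ) :
    thetaTerm (q ^ a) (q ^ b) k = q ^ (b * k + a * (k * (k - 1) / 2)) := by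
  rw [thetaTerm, zpow_add₀ hq, zpow_mul, zpow_mul, zpow_natCast, zpow_natCast]

/-- The theta function `f(q^6, q^10)` as an infinite product. -/
noncomputable def thetaSix (q : ℂ) : ℂ :=
  qPochInf (-q ^ 6) (q ^ 16) * qPochInf (-q ^ 10) (q ^ 16) * qPochInf (q ^ 16) (q ^ 16)

/-- The theta function `f(q^2, q^14)` as an infinite product. -/
noncomputable def thetaTwo (q : ℂ) : ℂ :=
  qPochInf (-q ^ 2) (q ^ 16) * qPochInf (-q ^ 14) (q ^ 16) * qPochInf (q ^ 16) (q ^ 16)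

/-- The 2-dissection of `(-q; q^2)_∞ (q^4; q^4)_∞`. -/
lemma theta_dissection {q : ℂ} (hq : ‖q‖ < 1) (hq0 : q ≠ 0) :
    qPochInf (-q) (q ^ 2) * qPochInf (q ^ 4) (q ^ 4) = thetaSix q + q * thetaTwo q := by
  have hpow : ∀ n : ℕ, q ^ n ≠ 0 := fun n => pow_ne_zero n hq0
  have h4 := jacobi_triple_product (norm_pow_lt_one hq four_ne_zero) (hpow 4) hq0
  have h6 := jacobi_triple_product (norm_pow_lt_one hq (by norm_num : 16 ≠ 0)) (hpow 16) (hpow 6)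
  have h14 := jacobi_triple_product (norm_pow_lt_one hq (by norm_num : 16 ≠ 0)) (hpow 16) (hpow 14)
  have d4 : q ^ 4 / q = q ^ 3 := by field_simp
  have d6 : q ^ 16 / q ^ 6 = q ^ 10 := by field_simp
  have d14 : q ^ 16 / q ^ 14 = q ^ 2 := by field_simp
  rw [d4] at h4
  rw [d6] at h6
  rw [d14, mul_comm (qPochInf (-q ^ 14) _)] at h14
  -- The exponent is `2k^2 - k`: at `2k` it is `6k + 8k(k-1)`, at `2k + 1` it is `1 + 14k +
  -- 8k(k-1)`.
  have e := h4.unique (HasSum.int_even_add_odd (a := thetaSix q) (b := q * thetaTwo q) ?_ ?_)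
  · rw [← e, qPochInf_split (-q) (norm_pow_lt_one hq two_ne_zero)]
    ring_nf
  · refine h6.congr_fun fun k => ?_
    have t1 := two_mul_triangle (2 * k)
    have t2 := two_mul_triangle k
    have := thetaTerm_pow hq0 4 1 (2 * k)
    rw [pow_one] at this
    rw [this, thetaTerm_pow hq0]
    congr 1
    push_cast
    linarith
  · refine (h14.mul_left q).congr_fun fun k => ?_
    have t1 := two_mul_triangle (2 * k + 1)
    have t2 := two_mul_triangle k
    have := thetaTerm_pow hq0 4 1 (2 * k + 1)
    rw [pow_one] at this
    rw [this, thetaTerm_pow hq0, ← zpow_one_add₀ hq0]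
    congr 1
    push_cast
    linarith

lemma thetaSix_neg (q : ℂ) : thetaSix (-q) = thetaSix q := by
  simp [thetaSix, Even.neg_pow (by decide : Even 6), Even.neg_pow (by decide : Even 10),
    Even.neg_pow (by decide : Even 16)]

lemma thetaTwo_neg (q : ℂ) : thetaTwo (-q) = thetaTwo q := by
  simp [thetaTwo, Even.neg_pow (by decide : Even 14), Even.neg_pow (by decide : Even 16)]

lemma theta_dissection_neg {q : ℂ} (hq : ‖q‖ < 1) (hq0 : q ≠ 0) :
    qPochInf q (q ^ 2) * qPochInf (q ^ 4) (q ^ 4) = thetaSix q - q * thetaTwo q := by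
  have h := theta_dissection (q := -q) (by simpa using hq) (neg_ne_zero.2 hq0)
  rw [thetaSix_neg, thetaTwo_neg, Even.neg_pow (by decide : Even 2),
    Even.neg_pow (by decide : Even 4), neg_neg] at h
  rw [h]
  ring

lemma qPochInf_self_ne_zero {q : ℂ} (hq : ‖q‖ < 1) {m n : ℕ} (hm : m ≠ 0) (hn : n ≠ 0) :
    qPochInf (q ^ m) (q ^ n) ≠ 0 :=
  qPochInf_ne_zero (norm_pow_lt_one hq hn)
    (mul_pow_ne_one (norm_pow_lt_one hq hm) (norm_pow_lt_one hq hn))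

lemma qPochInf_sq_eq {q : ℂ} (hq : ‖q‖ < 1) : qPochInf (q ^ 2) (q ^ 2) =
    qPochInf q (q ^ 2) * qPochInf (-q) (q ^ 2) * qPochInf (q ^ 4) (q ^ 4) := by
  have hq2 := norm_pow_lt_one hq two_ne_zero
  rw [qPochInf_mul_neg q hq2, qPochInf_split (q ^ 2) hq2]
  ring_nf

lemma thetaTwo_quotient {q : ℂ} (hq : ‖q‖ < 1) (hq0 : q ≠ 0) :
    q * (2 * thetaTwo q * (qPochInf (-q) (q ^ 2) / qPochInf (q ^ 2) (q ^ 2))) =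
      qPochInf (-q) (q ^ 2) / qPochInf q (q ^ 2) - 1 := by
  have h1 := theta_dissection hq hq0
  have h2 := theta_dissection_neg hq hq0
  have h3 := qPochInf_sq_eq hq
  have h4 := qPochInf_self_ne_zero hq two_ne_zero two_ne_zero
  rw [h3] at h4 ⊢
  have n1 := right_ne_zero_of_mul h4
  have n2 := left_ne_zero_of_mul (left_ne_zero_of_mul h4)
  have n3 := right_ne_zero_of_mul (left_ne_zero_of_mul h4)
  field_simp
  linear_combination h2 - h1

lemma thetaSix_quotient {q : ℂ} (hq : ‖q‖ < 1) (hq0 : q ≠ 0) :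
    2 * (thetaSix q * (qPochInf (-q) (q ^ 2) / qPochInf (q ^ 2) (q ^ 2))) =
      qPochInf (-q) (q ^ 2) / qPochInf q (q ^ 2) + 1 := by
  have h1 := theta_dissection hq hq0
  have h2 := theta_dissection_neg hq hq0
  have h3 := qPochInf_sq_eq hq
  have h4 := qPochInf_self_ne_zero hq two_ne_zero two_ne_zero
  rw [h3] at h4 ⊢
  have n1 := right_ne_zero_of_mul h4
  have n2 := left_ne_zero_of_mul (left_ne_zero_of_mul h4)
  have n3 := right_ne_zero_of_mul (left_ne_zero_of_mul h4)
  field_simp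
  linear_combination -h2 - h1

/-- Pure product bookkeeping: `(q^12;q^32)_∞` and `(q^20;q^32)_∞` each factor as `(x;q^16)_∞
(-x;q^16)_∞`, with `x = q^6` and `x = q^10`, while `(q;q^2)_∞ (-q;q^2)_∞ = (q^2;q^4)_∞` splits into
residues modulo 16. -/
lemma thetaSix_quotient_eq {q : ℂ} (hq : ‖q‖ < 1) :
    thetaSix q * (qPochInf (-q) (q ^ 2) / qPochInf (q ^ 2) (q ^ 2)) =
      (qPochInf (q ^ 2) (q ^ 16) * qPochInf (q ^ 14) (q ^ 16) * qPochInf (q ^ 16) (q ^ 16)) *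
        (qPochInf (q ^ 12) (q ^ 32) * qPochInf (q ^ 20) (q ^ 32)) / qPochInf q q := by
  have n1 := qPochInf_self_ne_zero hq two_ne_zero two_ne_zero
  have n2 := qPochInf_self_ne_zero hq one_ne_zero two_ne_zero
  have hq2 := norm_pow_lt_one hq two_ne_zero
  have hq4 := norm_pow_lt_one hq four_ne_zero
  have hq8 := norm_pow_lt_one hq (by norm_num : 8 ≠ 0)
  have hq16 := norm_pow_lt_one hq (by norm_num : 16 ≠ 0)
  have e0 := qPochInf_split q hq
  have e1 := qPochInf_mul_neg q hq2
  have e2 := qPochInf_split (q ^ 2) hq4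
  have e3 := qPochInf_split (q ^ 2) hq8
  have e4 := qPochInf_split (q ^ 6) hq8
  have e5 := qPochInf_mul_neg (q ^ 6) hq16
  have e6 := qPochInf_mul_neg (q ^ 10) hq16
  simp only [← pow_mul, ← pow_add, Nat.reduceMul, Nat.reduceAdd, pow_one]
    at e0 e1 e2 e3 e4 e5 e6 n2
  rw [e0, ← pow_two, ← e5, ← e6, thetaSix]
  rw [e2, e3, e4] at e1
  field_simp
  linear_combination
    qPochInf (-q ^ 6) (q ^ 16) * qPochInf (-q ^ 10) (q ^ 16) * qPochInf (q ^ 16) (q ^ 16) * e1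

/-! ### The two series -/

lemma qPoch_double (q : ℂ) (n : ℕ) :
    qPoch q q (2 * n + 1) = (1 - q) * (qPoch (q ^ 2) (q ^ 2) n * qPoch (q ^ 3) (q ^ 2) n) := by
  induction n with
  | zero => simp [qPoch]
  | succ n ih =>
    rw [show 2 * (n + 1) + 1 = 2 * n + 1 + 1 + 1 by ring, qPoch_succ, qPoch_succ, ih, qPoch_succ,
      qPoch_succ]
    ring

lemma hasSum_second {q : ℂ} (hq : ‖q‖ < 1) :
    HasSum (fun n : ℕ => qPoch (-q ^ 2) (q ^ 2) n * q ^ (n ^ 2) / qPoch q q (2 * n + 1))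
      (qPochInf (-q) (q ^ 2) / qPochInf q (q ^ 2)) := by
  have hq2 := norm_pow_lt_one hq two_ne_zero
  have h3 : -q ^ 2 * -q = q ^ 3 := by ring
  -- With this choice `a z = q^3`, so the denominators `(q^2;q^2)_n (q^3;q^2)_n` combine to
  -- `(q;q)_{2n+1} / (1 - q)`.
  have h := qGauss_hasSum (a := -q ^ 2) (p := q ^ 2) (z := -q) hq2 (by
    rw [h3]
    exact mul_pow_ne_one (norm_pow_lt_one hq three_ne_zero) hq2)
  have hI : qPochInf q (q ^ 2) = (1 - q) * qPochInf (q ^ 3) (q ^ 2) := by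
    refine tendsto_nhds_unique ((qPochInf_tendsto q hq2).comp (tendsto_add_atTop_nat 1)) ?_
    convert (qPochInf_tendsto (q ^ 3) hq2).const_mul (1 - q) using 2 with n
    rw [Function.comp_apply, qPoch_succ_left, ← pow_succ']
  have hv : qPochInf (-q) (q ^ 2) / qPochInf q (q ^ 2) =
      (1 - q)⁻¹ * (qPochInf (-q) (q ^ 2) / qPochInf (-q ^ 2 * -q) (q ^ 2)) := by
    rw [hI, h3]
    simp only [div_eq_mul_inv, mul_inv]
    ring
  rw [hv]
  refine (h.mul_left (1 - q)⁻¹).congr_fun fun n => ?_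
  have he : (n.choose 2) * 2 + n = n ^ 2 := by
    have := two_mul_choose_two n
    zify
    linear_combination this
  rw [qGaussTerm, h3, qPoch_double, neg_neg, ← he, pow_add, mul_comm _ 2, pow_mul]
  simp only [div_eq_mul_inv, mul_inv]
  ring

theorem mainTheorem9 (q : ℂ) (hq : ‖q‖ < 1) :
    HasSum
      (fun n : ℕ =>
        qPoch (-q ^ 2) (q ^ 2) (n + 1) * q ^ (n ^ 2 + 2 * n) / qPoch q q (2 * n + 3))
      (2 * (qPochInf (-q ^ 2) (q ^ 16) * qPochInf (-q ^ 14) (q ^ 16) *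
            qPochInf (q ^ 16) (q ^ 16)) *
          (qPochInf (-q) (q ^ 2) / qPochInf (q ^ 2) (q ^ 2)) - 1 / (1 - q)) ∧
    HasSum
      (fun n : ℕ =>
        qPoch (-q ^ 2) (q ^ 2) n * q ^ (n ^ 2) / qPoch q q (2 * n + 1))
      (2 * ((qPochInf (q ^ 2) (q ^ 16) * qPochInf (q ^ 14) (q ^ 16) *
              qPochInf (q ^ 16) (q ^ 16)) *
            (qPochInf (q ^ 12) (q ^ 32) * qPochInf (q ^ 20) (q ^ 32)) /
          qPochInf q q) - 1) := by
  -- The triple product and the division by `q` both need `q ≠ 0`; at `q = 0` each series reduces to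
  -- its term `n = 0`.
  rcases eq_or_ne q 0 with rfl | hq0
  · have z1 : ∀ n : ℕ, qPoch 0 0 n = 1 := fun n => by simp [qPoch]
    constructor
    · convert hasSum_ite_eq (0 : ℕ) (1 : ℂ) using 1
      · funext n
        rcases n with _ | n <;> simp [z1]
      · norm_num [qPochInf_zero]
    · convert hasSum_ite_eq (0 : ℕ) (1 : ℂ) using 1
      · funext n
        rcases n with _ | n <;> simp [z1]
      · norm_num [qPochInf_zero]
  have hs := hasSum_second hq
  constructor
  · have h1 := (hasSum_nat_add_iff' 1).2 hs
    have ht := thetaTwo_quotient hq hq0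
    have h1q : 1 - q ≠ 0 := sub_ne_zero.2 (by simpa using (mul_pow_ne_one hq hq 0).symm)
    have hv : 2 * thetaTwo q * (qPochInf (-q) (q ^ 2) / qPochInf (q ^ 2) (q ^ 2)) - 1 / (1 - q) =
        q⁻¹ * (qPochInf (-q) (q ^ 2) / qPochInf q (q ^ 2) - ∑ i ∈ Finset.range 1,
          qPoch (-q ^ 2) (q ^ 2) i * q ^ (i ^ 2) / qPoch q q (2 * i + 1)) := by
      rw [eq_inv_mul_iff_mul_eq₀ hq0, mul_sub, ht]
      simp [qPoch]
      field_simp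
      ring
    change HasSum _ (2 * thetaTwo q * _ - _)
    rw [hv]
    refine (h1.mul_left q⁻¹).congr_fun fun n => ?_
    rw [show 2 * (n + 1) + 1 = 2 * n + 3 by ring, show (n + 1) ^ 2 = n ^ 2 + 2 * n + 1 by ring,
      pow_succ q (n ^ 2 + 2 * n)]
    field_simp
  · rw [← thetaSix_quotient_eq hq, thetaSix_quotient hq hq0, add_sub_cancel_right]
    exact hs
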